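/- Let $\mathcal X,\mathcal Y,\mathcal Z$ be finite alphabets. A discrete memoryless channel with one disturbance constraint is a collection of conditional pmfs $p(y,z\mid x)$ on $\mathcal Y\times\mathcal Z$, $x\in\mathcal X$. For $R\ge 0$, a $(2^{nR},n)$ code consists of a message set of size $\lceil 2^{nR}\rceil$, an encoding function from messages to codewords in $\mathcal X^n$, and a decoding function from $\mathcal Y^n$ to messages. The message $M$ is uniformly distributed, its codeword $X^n$ is sent over the channel without feedback, $Y^n$ and $Z^n$ are the resulting memoryless outputs, and $\hat M$ is the decoded message. A pair $(R,R_{\rm d})$ with $R,R_{\rm d}\ge 0$ is achievable if there is a sequence of $(2^{nR},n)$ codes with $$\lim_{n\to\infty}\mathbb P(\hat M\ne M)=0\quad\text{and}\quad \limsup_{n\to\infty}\tfrac1n I(X^n;Z^n)\le R_{\rm d}.$$ The rate--disturbance region $\mathscr R$ is the closure of the set of achievable pairs. Logarithms are to base $2$. **Corollary.** Suppose the channel is deterministic, that is, $Y=f(X)$ and $Z=g(X)$ for functions $f:\mathcal X\to\mathcal Y$ and $g:\mathcal X\to\mathcal Z$. Then $\mathscr R$ is the set of pairs $(R,R_{\rm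 d})$ with $R,R_{\rm d}\ge 0$ such that $$R\le H(Y),\qquad R-R_{\rm d}\le H(Y\mid Z)$$ for some pmf $p(x)$ on $\mathcal X$. Equivalently, $\mathscr R$ is the set of pairs $(R,R_{\rm d})$ with $R,R_{\rm d}\ge 0$ such that $$R\le H(Y\mid Q),\qquad R_{\rm d}\ge I(Y;Z\mid Q)$$ for some joint pmf $p(q,x)$ on $\mathcal Q\times\mathcal X$, where $\mathcal Q$ is a finite set with $|\mathcal Q|\le 2$, $Y=f(X)$ and $Z=g(X)$. -/

import Mathlib

open scoped BigOperators Topology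

noncomputable section

namespace DisturbanceConstraint

/-! ### Information measures on a finite probability space

`p : Ω → ℝ` is a pmf on a finite set `Ω`, random variables are functions on `Ω`, and logarithms
are to base `2`. Terms of probability zero contribute `0`. -/

section Information

variable {Ω α β γ : Type*} [Fintype Ω] [Fintype α] [Fintype β] [Fintype γ]

/-- The probability of the event `E` under the pmf `p`. -/
def prob (p : Ω → ℝ) (E : Ω → Prop) : ℝ :=
  open Classical in ∑ ω with E ω, p ω

/-- The pmf of the random variable `A` under `p`, that is `a ↦ P(A = a)`. -/
def law (p : Ω → ℝ) (A : Ω → α) (a : α) : ℝ :=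
  prob p (fun ω => A ω = a)

/-- Entropy `H(A) = - ∑ P(a) log P(a)`. -/
def entropy (p : Ω → ℝ) (A : Ω → α) : ℝ :=
  -∑ a, law p A a * Real.logb 2 (law p A a)

/-- Conditional entropy `H(A | B) = - ∑ P(a, b) log P(a | b)`. -/
def condEntropy (p : Ω → ℝ) (A : Ω → α) (B : Ω → β) : ℝ :=
  -∑ a, ∑ b, law p (fun ω => (A ω, B ω)) (a, b) *
    Real.logb 2 (law p (fun ω => (A ω, B ω)) (a, b) / law p B b)

/-- Mutual information `I(A; B) = ∑ P(a, b) log (P(a, b) / (P(a) P(b)))`. -/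
def mutualInfo (p : Ω → ℝ) (A : Ω → α) (B : Ω → β) : ℝ :=
  ∑ a, ∑ b, law p (fun ω => (A ω, B ω)) (a, b) *
    Real.logb 2 (law p (fun ω => (A ω, B ω)) (a, b) / (law p A a * law p B b))

/-- Conditional mutual information
`I(A; B | C) = ∑ P(a, b, c) log (P(a, b | c) / (P(a | c) P(b | c)))`. -/
def condMutualInfo (p : Ω → ℝ) (A : Ω → α) (B : Ω → β) (C : Ω → γ) : ℝ :=
  ∑ a, ∑ b, ∑ c, law p (fun ω => (A ω, B ω, C ω)) (a, b, c) *
    Real.logb 2 ((law p (fun ω => (A ω, B ω, C ω)) (a, b, c) / law p C c) /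
      ((law p (fun ω => (A ω, C ω)) (a, c) / law p C c) *
        (law p (fun ω => (B ω, C ω)) (b, c) / law p C c)))

end Information

/-! ### Communication with one disturbance constraint -/

/-- A discrete memoryless channel with one disturbance constraint: finite alphabets `X`, `Y`, `Z`
and a collection of conditional pmfs `p(y, z | x)`. -/
structure Channel (X Y Z : Type*) [Fintype Y] [Fintype Z] where
  /-- `W x (y, z) = p(y, z | x)` -/
  W : X → Y × Z → ℝ
  isPMF : ∀ x, W x ∈ stdSimplex ℝ (Y × Z)

/-- The deterministic channel with outputs `Y = f(X)` and `Z = g(X)`. -/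
def Channel.deterministic {X Y Z : Type*} [Fintype Y] [Fintype Z] (f : X → Y) (g : X → Z) :
    Channel X Y Z where
  W x := open Classical in Pi.single (f x, g x) 1
  isPMF x := by
    classical
    exact single_mem_stdSimplex ℝ (f x, g x)

/-- A block code of length `n` with message set `Fin N`: an encoding function
`Fin N → X ^ n` and a decoding function `Y ^ n → Fin N`. -/
structure Code (X Y : Type*) (N n : ℕ) where
  enc : Fin N → (Fin n → X)
  dec : (Fin n → Y) → Fin N

namespace Code

variable {X Y Z : Type*} [Fintype X] [Fintype Y] [Fintype Z] {N n : ℕ}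

/-- The joint pmf of the message and of the output sequence `((Y₁, Z₁), …, (Yₙ, Zₙ))`, when the
message is uniform on `Fin N` and its codeword is sent over the memoryless channel `C`. -/
def jointPMF (c : Code X Y N n) (C : Channel X Y Z) : Fin N × (Fin n → Y × Z) → ℝ :=
  fun ω => (1 / (N : ℝ)) * ∏ i, C.W (c.enc ω.1 i) (ω.2 i)

/-- The probability of error `P(M̂ ≠ M)`, where `M̂` is the decoder's output on `Yⁿ`. -/
def errorProb (c : Code X Y N n) (C : Channel X Y Z) : ℝ :=
  prob (c.jointPMF C) (fun ω => c.dec (fun i => (ω.2 i).1) ≠ ω.1)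

/-- The information `I(Xⁿ; Zⁿ)` between the transmitted sequence and the side receiver's
sequence. -/
def disturbance (c : Code X Y N n) (C : Channel X Y Z) : ℝ :=
  mutualInfo (c.jointPMF C) (fun ω => c.enc ω.1) (fun ω i => (ω.2 i).2)

end Code

/-- The size of the message set of a `(2 ^ (n R), n)` code. -/
def numMessages (R : ℝ) (n : ℕ) : ℕ := ⌈(2 : ℝ) ^ ((n : ℝ) * R)⌉₊

section Region

variable {X Y Z : Type*} [Fintype X] [Fintype Y] [Fintype Z]

/-- Achievability of a rate--disturbance pair `(R, R_d)`. The limit superior is taken in the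
extended reals, so that it needs no boundedness side condition. -/
def Achievable (C : Channel X Y Z) (R Rd : ℝ) : Prop :=
  0 ≤ R ∧ 0 ≤ Rd ∧
    ∃ c : (n : ℕ) → Code X Y (numMessages R n) n,
      Filter.Tendsto (fun n => (c n).errorProb C) Filter.atTop (𝓝 0) ∧
      Filter.limsup (fun n : ℕ => (((1 / (n : ℝ)) * (c n).disturbance C : ℝ) : EReal))
        Filter.atTop ≤ (Rd : EReal)

/-- The rate--disturbance region: the closure of the set of achievable pairs. -/
def rateDisturbanceRegion (C : Channel X Y Z) : Set (ℝ × ℝ) :=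
  closure {r | Achievable C r.1 r.2}

end Region

end DisturbanceConstraint

end

/-! For a deterministic channel the disturbance I(Xⁿ;Zⁿ) of a code is H(Zⁿ), so the problem is to
send many distinguishable sequences Yⁿ while keeping the entropy of Zⁿ small.

Converse. Condition the uniform message on the set of correctly decoded messages. There Yⁿ
determines the message, so H(Yⁿ) is the logarithm of the size of that set, and no Fano inequality is
needed; H(Zⁿ) grows by at most the factor 1/(1-e) (`mul_entropy_le_of_le`). Gibbs' inequality
against a product kernel single-letterizes both H(Yⁿ) and H(Yⁿ|Zⁿ) with the same average letter law
(`condEntropy_seq_le`). The limit is taken inside a closed region (`isClosed_entropyRegion`).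

Achievability. No random coding: among typical sequences, `exists_cover` greedily picks about 2^(n
Rd) values of Zⁿ whose preimages show about 2^(n min(H(Y), Rd + H(Y|Z))) values of Yⁿ. One codeword
per value of Yⁿ makes no errors, and H(Zⁿ) is at most the logarithm of the number of chosen values.

The time-sharing form follows from `entropyRegion_iff_timeSharing`: a pmf is mixed with one of its
conditionals given Z = z, which causes no disturbance and, for a suitable z, keeps H(Y) at least
H(Y|Z). -/

noncomputable section

namespace DisturbanceConstraint

/-! ### Laws, information identities and Gibbs' inequality -/

section InformationLemmas

variable {Ω α β γ : Type*} [Fintype Ω]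

open Classical in
theorem law_eq_sum_ite (p : Ω → ℝ) (A : Ω → α) (a : α) :
    law p A a = ∑ ω, if A ω = a then p ω else 0 := by
  simp only [law, prob, Finset.sum_filter]

theorem law_nonneg {p : Ω → ℝ} (hp : ∀ ω, 0 ≤ p ω) (A : Ω → α) (a : α) : 0 ≤ law p A a := by
  classical
  rw [law_eq_sum_ite]
  exact Finset.sum_nonneg fun ω _ => by split_ifs <;> simp [hp]

theorem le_law {p : Ω → ℝ} (hp : ∀ ω, 0 ≤ p ω) (A : Ω → α) (ω : Ω) : p ω ≤ law p A (A ω) := by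
  classical
  rw [law_eq_sum_ite]
  refine le_trans (by simp) (Finset.single_le_sum (f := fun ω' => if A ω' = A ω then p ω' else 0)
    (fun ω' _ => ?_) (Finset.mem_univ ω))
  split_ifs <;> simp [hp]

theorem law_pos {p : Ω → ℝ} (hp : ∀ ω, 0 ≤ p ω) (A : Ω → α) {ω : Ω} (h : p ω ≠ 0) :
    0 < law p A (A ω) :=
  (lt_of_le_of_ne (hp ω) h.symm).trans_le (le_law hp A ω)

theorem law_comp_injective (p : Ω → ℝ) (A : Ω → α) {h : α → β} (hh : Function.Injective h) (a : α) :
    law p (fun ω => h (A ω)) (h a) = law p A a := by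
  classical
  simp only [law_eq_sum_ite, hh.eq_iff]

variable [Fintype α]

theorem sum_law_mul (p : Ω → ℝ) (A : Ω → α) (F : α → ℝ) :
    ∑ a, law p A a * F a = ∑ ω, p ω * F (A ω) := by
  classical
  simp only [law_eq_sum_ite, Finset.sum_mul, ite_mul, zero_mul]
  rw [Finset.sum_comm]
  simp

theorem sum_law (p : Ω → ℝ) (A : Ω → α) : ∑ a, law p A a = ∑ ω, p ω := by
  simpa using sum_law_mul p A (fun _ => 1)

theorem law_mem_stdSimplex {p : Ω → ℝ} (hp : p ∈ stdSimplex ℝ Ω) (A : Ω → α) :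
    law p A ∈ stdSimplex ℝ α :=
  ⟨law_nonneg hp.1 A, by rw [sum_law, hp.2]⟩

theorem law_le_one {p : Ω → ℝ} (hp : p ∈ stdSimplex ℝ Ω) (A : Ω → α) (a : α) : law p A a ≤ 1 := by
  have h := law_mem_stdSimplex hp A
  rw [← h.2]
  exact Finset.single_le_sum (fun a _ => h.1 a) (Finset.mem_univ a)

theorem sum_law_pair_left (p : Ω → ℝ) (A : Ω → α) (B : Ω → β) (b : β) :
    ∑ a, law p (fun ω => (A ω, B ω)) (a, b) = law p B b := by
  classical
  simp only [law_eq_sum_ite, Prod.mk.injEq, ite_and]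
  rw [Finset.sum_comm]
  simp

theorem law_law (p : Ω → ℝ) (A : Ω → α) (h : α → β) :
    law (law p A) h = law p (fun ω => h (A ω)) := by
  classical
  funext b
  rw [law_eq_sum_ite, law_eq_sum_ite]
  simpa using sum_law_mul p A (fun a => if h a = b then 1 else 0)

theorem sum_law_div_le_one (p : Ω → ℝ) (A : Ω → α) (B : Ω → β) (b : β) :
    ∑ a, law p (fun ω => (A ω, B ω)) (a, b) / law p B b ≤ 1 := by
  rw [← Finset.sum_div, sum_law_pair_left]
  exact div_self_le_one _

variable [Fintype β] [Fintype γ]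

/-- As an expectation over the sample space, this and the analogous formulas below let information
identities be checked outcome by outcome: outcomes of mass zero drop out, and on the others all the
laws involved are positive. -/
theorem entropy_eq_sum (p : Ω → ℝ) (A : Ω → α) :
    entropy p A = -∑ ω, p ω * Real.logb 2 (law p A (A ω)) := by
  rw [entropy, sum_law_mul p A (fun a => Real.logb 2 (law p A a))]

theorem condEntropy_eq_sum (p : Ω → ℝ) (A : Ω → α) (B : Ω → β) :
    condEntropy p A B = -∑ ω, p ω *
      Real.logb 2 (law p (fun ω => (A ω, B ω)) (A ω, B ω) / law p B (B ω)) := by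
  rw [condEntropy, ← Fintype.sum_prod_type', ← sum_law_mul p (fun ω => (A ω, B ω))
    (fun ab => Real.logb 2 (law p (fun ω => (A ω, B ω)) ab / law p B ab.2))]

theorem mutualInfo_eq_sum (p : Ω → ℝ) (A : Ω → α) (B : Ω → β) :
    mutualInfo p A B = ∑ ω, p ω * Real.logb 2
      (law p (fun ω => (A ω, B ω)) (A ω, B ω) / (law p A (A ω) * law p B (B ω))) := by
  rw [mutualInfo, ← Fintype.sum_prod_type', ← sum_law_mul p (fun ω => (A ω, B ω))
    (fun ab => Real.logb 2 (law p (fun ω => (A ω, B ω)) ab / (law p A ab.1 * law p B ab.2)))]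

theorem condMutualInfo_eq_sum (p : Ω → ℝ) (A : Ω → α) (B : Ω → β) (C : Ω → γ) :
    condMutualInfo p A B C = ∑ ω, p ω * Real.logb 2
      ((law p (fun ω => (A ω, B ω, C ω)) (A ω, B ω, C ω) / law p C (C ω)) /
      ((law p (fun ω => (A ω, C ω)) (A ω, C ω) / law p C (C ω)) *
        (law p (fun ω => (B ω, C ω)) (B ω, C ω) / law p C (C ω)))) := by
  rw [condMutualInfo, ← sum_law_mul p (fun ω => (A ω, B ω, C ω))
    (fun x => Real.logb 2 ((law p (fun ω => (A ω, B ω, C ω)) x / law p C x.2.2) /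
      ((law p (fun ω => (A ω, C ω)) (x.1, x.2.2) / law p C x.2.2) *
        (law p (fun ω => (B ω, C ω)) x.2 / law p C x.2.2)))), Fintype.sum_prod_type]
  simp only [Fintype.sum_prod_type]

/-- Entropy as a conditional entropy given a constant. -/
theorem entropy_eq_condEntropy_const {p : Ω → ℝ} (hp : p ∈ stdSimplex ℝ Ω) (A : Ω → α) (b : β) :
    entropy p A = condEntropy p A (fun _ => b) := by
  have h : law p (fun _ => b) b = 1 := by
    rw [law_eq_sum_ite]; simpa using hp.2
  have h2 : ∀ a, law p (fun ω => (A ω, b)) (a, b) = law p A a :=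
    law_comp_injective p A (h := fun a => (a, b)) fun a b hab => by simpa using hab
  simp only [entropy_eq_sum, condEntropy_eq_sum, h, h2, div_one]

theorem condEntropy_eq_entropy_sub {p : Ω → ℝ} (hp : ∀ ω, 0 ≤ p ω) (A : Ω → α) (B : Ω → β) :
    condEntropy p A B = entropy p (fun ω => (A ω, B ω)) - entropy p B := by
  rw [condEntropy_eq_sum, entropy_eq_sum, entropy_eq_sum, neg_sub_neg, ← Finset.sum_sub_distrib,
    ← Finset.sum_neg_distrib]
  refine Finset.sum_congr rfl fun ω _ => ?_
  by_cases h : p ω = 0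
  · simp [h]
  rw [Real.logb_div (law_pos hp (fun ω => (A ω, B ω)) h).ne' (law_pos hp B h).ne']
  ring

theorem mutualInfo_comp_right {p : Ω → ℝ} (hp : ∀ ω, 0 ≤ p ω) (A : Ω → α) (h : α → β) :
    mutualInfo p A (fun ω => h (A ω)) = entropy p (fun ω => h (A ω)) := by
  rw [mutualInfo_eq_sum, entropy_eq_sum, ← Finset.sum_neg_distrib]
  refine Finset.sum_congr rfl fun ω _ => ?_
  by_cases h0 : p ω = 0
  · simp [h0]
  have h2 := law_comp_injective p A (h := fun a => (a, h a))
    (fun a b hab => by simp at hab; exact hab.1) (A ω)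
  have h1 := law_pos hp A h0
  rw [h2, div_mul_cancel_left₀ h1.ne', Real.logb_inv]
  ring

theorem condEntropy_sub_condMutualInfo {p : Ω → ℝ} (hp : ∀ ω, 0 ≤ p ω) (A : Ω → α) (B : Ω → β)
    (C : Ω → γ) :
    condEntropy p A C - condMutualInfo p A B C = condEntropy p A (fun ω => (B ω, C ω)) := by
  rw [condEntropy_eq_sum, condEntropy_eq_sum, condMutualInfo_eq_sum, ← Finset.sum_neg_distrib,
    ← Finset.sum_sub_distrib, ← Finset.sum_neg_distrib]
  refine Finset.sum_congr rfl fun ω _ => ?_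
  by_cases h0 : p ω = 0
  · simp [h0]
  have h1 := law_pos hp C h0
  have h2 := law_pos hp (fun ω => (A ω, C ω)) h0
  have h3 := law_pos hp (fun ω => (B ω, C ω)) h0
  have h4 := law_pos hp (fun ω => (A ω, B ω, C ω)) h0
  rw [Real.logb_div (by positivity) (by positivity), Real.logb_div (by positivity) (by positivity),
    Real.logb_div (by positivity) (by positivity), Real.logb_mul (by positivity) (by positivity),
    Real.logb_div (by positivity) (by positivity), Real.logb_div (by positivity) (by positivity),
    Real.logb_div (by positivity) (by positivity)]
  ring

/-- Gibbs' inequality: the conditional entropy is at most the cross entropy with respect to any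
(sub-)kernel that is positive on the support. -/
theorem condEntropy_le_crossEntropy {p : Ω → ℝ} (hp : p ∈ stdSimplex ℝ Ω) (A : Ω → α) (B : Ω → β)
    (q : α → β → ℝ) (hq : ∀ a b, 0 ≤ q a b) (hq1 : ∀ b, ∑ a, q a b ≤ 1)
    (hpos : ∀ ω, p ω ≠ 0 → 0 < q (A ω) (B ω)) :
    condEntropy p A B ≤ -∑ ω, p ω * Real.logb 2 (q (A ω) (B ω)) := by
  have hl2 : 0 < Real.log 2 := Real.log_pos (by norm_num)
  set l := law p (fun ω => (A ω, B ω)) with hl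
  -- This is log u ≤ u - 1 for the likelihood ratio u of the kernel `q` to the true conditional law.
  -- The next bound says that u has expectation at most 1.
  have key : ∀ ω, p ω * Real.logb 2 (q (A ω) (B ω)) -
      p ω * Real.logb 2 (l (A ω, B ω) / law p B (B ω)) ≤
      (Real.log 2)⁻¹ * (p ω * (q (A ω) (B ω) * law p B (B ω) / l (A ω, B ω)) - p ω) := by
    intro ω
    by_cases h0 : p ω = 0
    · simp [h0]
    have h1 := law_pos hp.1 B h0
    have h2 : 0 < l (A ω, B ω) := law_pos hp.1 (fun ω => (A ω, B ω)) h0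
    have h3 := hpos ω h0
    have h4 := Real.log_le_sub_one_of_pos
      (show 0 < q (A ω) (B ω) * law p B (B ω) / l (A ω, B ω) by positivity)
    rw [← mul_sub, ← Real.logb_div (by positivity) (by positivity), div_div_eq_mul_div, Real.logb,
      ← mul_sub_one, mul_left_comm, div_eq_inv_mul]
    gcongr
    exact hp.1 ω
  have h1 : ∑ ω, p ω * (q (A ω) (B ω) * law p B (B ω) / l (A ω, B ω)) ≤ 1 := by
    rw [← sum_law_mul p (fun ω => (A ω, B ω)) (fun ab => q ab.1 ab.2 * law p B ab.2 / l ab)]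
    calc ∑ ab, l ab * (q ab.1 ab.2 * law p B ab.2 / l ab)
        ≤ ∑ ab : α × β, q ab.1 ab.2 * law p B ab.2 := by
          refine Finset.sum_le_sum fun ab _ => ?_
          have h0 : 0 ≤ q ab.1 ab.2 * law p B ab.2 := mul_nonneg (hq _ _) (law_nonneg hp.1 _ _)
          by_cases h : l ab = 0
          · simpa [h] using h0
          · rw [mul_div_cancel₀ _ h]
      _ = ∑ b, (∑ a, q a b) * law p B b := by
          rw [Fintype.sum_prod_type_right]
          simp only [Finset.sum_mul]
      _ ≤ ∑ b, 1 * law p B b := by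
          gcongr with b
          · exact law_nonneg hp.1 _ _
          · exact hq1 b
      _ = 1 := by simp [sum_law, hp.2]
  have h2 := Finset.sum_le_sum fun ω (_ : ω ∈ Finset.univ) => key ω
  rw [← Finset.mul_sum, Finset.sum_sub_distrib, Finset.sum_sub_distrib, hp.2] at h2
  have h3 : (Real.log 2)⁻¹ * (∑ ω, p ω * (q (A ω) (B ω) * law p B (B ω) / l (A ω, B ω)) - 1) ≤ 0 :=
    mul_nonpos_of_nonneg_of_nonpos (by positivity) (by linarith)
  rw [condEntropy_eq_sum]
  linarith

theorem entropy_le_crossEntropy {p : Ω → ℝ} (hp : p ∈ stdSimplex ℝ Ω) (A : Ω → α)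
    (q : α → ℝ) (hq : ∀ a, 0 ≤ q a) (hq1 : ∑ a, q a ≤ 1) (hpos : ∀ ω, p ω ≠ 0 → 0 < q (A ω)) :
    entropy p A ≤ -∑ ω, p ω * Real.logb 2 (q (A ω)) := by
  rw [entropy_eq_condEntropy_const hp A ()]
  exact condEntropy_le_crossEntropy hp A _ (fun a _ => q a) (fun a _ => hq a) (fun _ => hq1) hpos

/-- A variable with at most `K` values has entropy at most `log K`. -/
theorem entropy_le_logb_card {p : Ω → ℝ} (hp : p ∈ stdSimplex ℝ Ω) (A : Ω → α) (S : Finset α)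
    (hA : ∀ ω, A ω ∈ S) {K : ℕ} (hK : S.card ≤ K) (hK0 : 0 < K) :
    entropy p A ≤ Real.logb 2 K := by
  classical
  have hK0' : (0 : ℝ) < K := by exact_mod_cast hK0
  refine (entropy_le_crossEntropy hp A (fun a => if a ∈ S then (K : ℝ)⁻¹ else 0)
    (fun a => by split_ifs <;> positivity) ?_ (fun ω _ => by simp [hA, hK0])).trans ?_
  · simp only [Finset.sum_ite_mem, Finset.univ_inter, Finset.sum_const, nsmul_eq_mul]
    rw [mul_inv_le_iff₀ hK0', one_mul]
    exact_mod_cast hK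
  · simp only [hA, if_true, ← Finset.sum_mul, hp.2, Real.logb_inv]
    simp

end InformationLemmas

/-! ### Conditioning inequalities and continuity -/

section MoreInformation

variable {Ω α β γ : Type*} [Fintype Ω] [Fintype α] [Fintype β] [Fintype γ]

theorem entropy_law (p : Ω → ℝ) (A : Ω → α) (h : α → β) :
    entropy (law p A) h = entropy p (fun ω => h (A ω)) := by
  simp only [entropy, law_law]

theorem condEntropy_law (p : Ω → ℝ) (A : Ω → α) (h : α → β) (k : α → γ) :
    condEntropy (law p A) h k = condEntropy p (fun ω => h (A ω)) (fun ω => k (A ω)) := by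
  simp only [condEntropy, law_law]

/-- Conditioning reduces entropy. -/
theorem condEntropy_le_entropy {p : Ω → ℝ} (hp : p ∈ stdSimplex ℝ Ω) (A : Ω → α) (B : Ω → β) :
    condEntropy p A B ≤ entropy p A := by
  rw [entropy_eq_sum]
  exact condEntropy_le_crossEntropy hp A B (fun a _ => law p A a) (fun a _ => law_nonneg hp.1 A a)
    (fun _ => by rw [sum_law, hp.2]) (fun ω h => law_pos hp.1 A h)

/-- Gibbs' inequality applied to the conditional law of `A` given `B`, read as a kernel that ignores
`C`. -/
theorem condEntropy_pair_le {p : Ω → ℝ} (hp : p ∈ stdSimplex ℝ Ω) (A : Ω → α) (B : Ω → β)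
    (C : Ω → γ) : condEntropy p A (fun ω => (B ω, C ω)) ≤ condEntropy p A B := by
  have h := condEntropy_le_crossEntropy hp A (fun ω => (B ω, C ω))
    (fun a bc => law p (fun ω => (A ω, B ω)) (a, bc.1) / law p B bc.1)
    (fun a bc => div_nonneg (law_nonneg hp.1 _ _) (law_nonneg hp.1 _ _))
    (fun bc => sum_law_div_le_one p A B bc.1)
    (fun ω h => div_pos (law_pos hp.1 (fun ω => (A ω, B ω)) h) (law_pos hp.1 B h))
  rwa [← condEntropy_eq_sum p A B] at h

theorem mutualInfo_eq_entropy_sub {p : Ω → ℝ} (hp : ∀ ω, 0 ≤ p ω) (A : Ω → α) (B : Ω → β) :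
    mutualInfo p A B = entropy p A - condEntropy p A B := by
  rw [mutualInfo_eq_sum, entropy_eq_sum, condEntropy_eq_sum, neg_sub_neg,
    ← Finset.sum_sub_distrib]
  refine Finset.sum_congr rfl fun ω _ => ?_
  by_cases h : p ω = 0
  · simp [h]
  have h1 := law_pos hp A h
  have h2 := law_pos hp B h
  have h3 := law_pos hp (fun ω => (A ω, B ω)) h
  rw [Real.logb_div (by positivity) (by positivity), Real.logb_mul (by positivity) (by positivity),
    Real.logb_div (by positivity) (by positivity)]
  ring

theorem mutualInfo_eq_zero_of_const {p : Ω → ℝ} (hp : p ∈ stdSimplex ℝ Ω) (A : Ω → α) (B : Ω → β)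
    (b : β) (hB : ∀ ω, p ω ≠ 0 → B ω = b) : mutualInfo p A B = 0 := by
  classical
  have h1 : law p B b = 1 := by
    rw [law_eq_sum_ite, ← hp.2]
    refine Finset.sum_congr rfl fun ω _ => ?_
    by_cases h : p ω = 0 <;> simp_all
  have h2 : ∀ a, law p (fun ω => (A ω, B ω)) (a, b) = law p A a := by
    intro a
    rw [law_eq_sum_ite, law_eq_sum_ite]
    refine Finset.sum_congr rfl fun ω _ => ?_
    by_cases h : p ω = 0 <;> simp_all
  rw [mutualInfo_eq_sum]
  refine Finset.sum_eq_zero fun ω _ => ?_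
  by_cases h : p ω = 0
  · simp [h]
  rw [hB ω h, h1, h2, mul_one, div_self (law_pos hp.1 A h).ne']
  simp

theorem continuous_entropy (A : Ω → α) : Continuous fun p : Ω → ℝ => entropy p A := by
  classical
  have h : ∀ a, Continuous fun p : Ω → ℝ => law p A a := by
    intro a
    simp only [law_eq_sum_ite]
    refine continuous_finsetSum _ fun ω _ => ?_
    split_ifs <;> fun_prop
  unfold entropy
  refine (continuous_finsetSum _ fun a _ => ?_).neg
  simp only [Real.logb, ← mul_div_assoc]
  exact (Real.continuous_mul_log.comp (h a)).div_const _

/-- The quotient inside the logarithm is awkward where the law of `B` vanishes; on the simplex it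
disappears through H(A,B) - H(B), a difference of continuous functions. -/
theorem continuous_condEntropy (A : Ω → α) (B : Ω → β) :
    Continuous fun p : stdSimplex ℝ Ω => condEntropy (p : Ω → ℝ) A B := by
  have h : (fun p : stdSimplex ℝ Ω => condEntropy (p : Ω → ℝ) A B) =
      fun p : stdSimplex ℝ Ω => entropy (p : Ω → ℝ) (fun ω => (A ω, B ω)) - entropy (p : Ω → ℝ) B :=
    funext fun p => condEntropy_eq_entropy_sub p.2.1 A B
  rw [h]
  exact ((continuous_entropy _).comp continuous_subtype_val).sub
    ((continuous_entropy _).comp continuous_subtype_val)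

end MoreInformation

/-! ### Mixtures with a time-sharing variable -/

section Mixture

variable {Q X α β : Type*} [Fintype Q] [Fintype X]
  {w : Q → ℝ} {r : Q → X → ℝ}

theorem law_mixture (w : Q → ℝ) (r : Q → X → ℝ) (A : X → α) (a : α) (q : Q) :
    law (fun qx : Q × X => w qx.1 * r qx.1 qx.2) (fun qx => (A qx.2, qx.1)) (a, q) =
      w q * law (r q) A a := by
  classical
  simp only [law_eq_sum_ite, Fintype.sum_prod_type, Prod.mk.injEq, Finset.mul_sum, and_comm,
    ite_and]
  simp

theorem law_mixture_fst (hr : ∀ q, r q ∈ stdSimplex ℝ X) (q : Q) :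
    law (fun qx : Q × X => w qx.1 * r qx.1 qx.2) (fun qx => qx.1) q = w q := by
  classical
  simp only [law_eq_sum_ite, Fintype.sum_prod_type]
  simp [← Finset.mul_sum, (hr _).2]

theorem mixture_mem_stdSimplex (hw : w ∈ stdSimplex ℝ Q) (hr : ∀ q, r q ∈ stdSimplex ℝ X) :
    (fun qx : Q × X => w qx.1 * r qx.1 qx.2) ∈ stdSimplex ℝ (Q × X) := by
  refine ⟨fun qx => mul_nonneg (hw.1 _) ((hr _).1 _), ?_⟩
  rw [Fintype.sum_prod_type]
  simp [← Finset.mul_sum, (hr _).2, hw.2]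

variable [Fintype α] [Fintype β]

theorem condEntropy_mixture (hr : ∀ q, r q ∈ stdSimplex ℝ X) (A : X → α) :
    condEntropy (fun qx : Q × X => w qx.1 * r qx.1 qx.2) (fun qx => A qx.2) (fun qx => qx.1) =
      ∑ q, w q * entropy (r q) A := by
  simp only [condEntropy_eq_sum, entropy_eq_sum, law_mixture, law_mixture_fst hr,
    Fintype.sum_prod_type, ← Finset.sum_neg_distrib, Finset.mul_sum]
  refine Finset.sum_congr rfl fun q _ => Finset.sum_congr rfl fun x _ => ?_
  by_cases h : w q = 0
  · simp [h]
  rw [mul_div_cancel_left₀ _ h]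
  ring

theorem condMutualInfo_mixture (hr : ∀ q, r q ∈ stdSimplex ℝ X) (A : X → α) (B : X → β) :
    condMutualInfo (fun qx : Q × X => w qx.1 * r qx.1 qx.2) (fun qx => A qx.2) (fun qx => B qx.2)
      (fun qx => qx.1) = ∑ q, w q * mutualInfo (r q) A B := by
  have h3 : ∀ a b q, law (fun qx : Q × X => w qx.1 * r qx.1 qx.2)
      (fun qx => (A qx.2, B qx.2, qx.1)) (a, b, q) =
      w q * law (r q) (fun x => (A x, B x)) (a, b) := by
    intro a b q
    rw [← law_mixture]
    exact law_comp_injective _ (fun qx : Q × X => ((A qx.2, B qx.2), qx.1))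
      (Equiv.prodAssoc α β Q).injective ((a, b), q)
  simp only [condMutualInfo_eq_sum, mutualInfo_eq_sum, law_mixture, law_mixture_fst hr, h3,
    Fintype.sum_prod_type, Finset.mul_sum]
  refine Finset.sum_congr rfl fun q _ => Finset.sum_congr rfl fun x _ => ?_
  by_cases h : w q = 0
  · simp [h]
  simp only [mul_div_cancel_left₀ _ h]
  ring

end Mixture

/-! ### The single-letter regions -/

section Regions

variable {X Y Z : Type*} [Fintype X] [Fintype Y] [Fintype Z] (f : X → Y) (g : X → Z)

/-- Some value of `B` has conditional entropy of `A` at least the average `H(A | B)`. -/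
theorem exists_conditioned_entropy_ge {p : X → ℝ} (hp : p ∈ stdSimplex ℝ X) :
    ∃ p' ∈ stdSimplex ℝ X, ∃ z, (∀ x, p' x ≠ 0 → g x = z) ∧ condEntropy p f g ≤ entropy p' f := by
  classical
  -- The conditional pmf given `g x = z`; it is identically zero when z has probability zero, and
  -- such z carry no weight in the average.
  let c : Z → X → ℝ := fun z x => (if g x = z then p x else 0) / law p g z
  have hlaw : ∀ z y, law (c z) f y = law p (fun x => (f x, g x)) (y, z) / law p g z := by
    intro z y
    simp only [c, law_eq_sum_ite, Finset.sum_div, Prod.mk.injEq, ite_and]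
    exact Finset.sum_congr rfl fun x _ => by split_ifs <;> simp
  have hent : condEntropy p f g = ∑ z, law p g z * entropy (c z) f := by
    simp only [condEntropy_eq_sum, entropy_eq_sum, hlaw, ← Finset.sum_neg_distrib, Finset.mul_sum]
    rw [Finset.sum_comm]
    refine Finset.sum_congr rfl fun x _ => ?_
    rw [Finset.sum_eq_single (g x)]
    · by_cases h : p x = 0
      · simp [c, h]
      have := (law_pos hp.1 g h).ne'
      simp only [c, if_true]
      field_simp
    · intro z _ hz
      simp [c, hz.symm]
    · simp
  -- Otherwise every conditional entropy of positive weight lies strictly below H(A|B), which is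
  -- their average.
  by_contra! hcon
  have hlt : ∀ z, law p g z ≠ 0 → entropy (c z) f < condEntropy p f g := by
    intro z hz
    refine hcon (c z) ⟨fun x => ?_, ?_⟩ z fun x hx => ?_
    · exact div_nonneg (by split_ifs <;> simp [hp.1]) (law_nonneg hp.1 _ _)
    · rw [← Finset.sum_div, ← law_eq_sum_ite, div_self hz]
    · by_contra h
      simp [c, h] at hx
  obtain ⟨z, hz⟩ : ∃ z, law p g z ≠ 0 := by
    by_contra! h
    have := sum_law p g
    simp [h, hp.2] at this
  have : ∑ z, law p g z * entropy (c z) f < ∑ z, law p g z * condEntropy p f g := by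
    refine Finset.sum_lt_sum (fun z _ => ?_) ⟨z, Finset.mem_univ z, ?_⟩
    · by_cases h : law p g z = 0
      · simp [h]
      · exact mul_le_mul_of_nonneg_left (hlt z h).le (law_nonneg hp.1 _ _)
    · exact mul_lt_mul_of_pos_left (hlt z hz) (lt_of_le_of_ne (law_nonneg hp.1 _ _) hz.symm)
  rw [← hent, ← Finset.sum_mul, sum_law, hp.2, one_mul] at this
  exact lt_irrefl _ this

/-- The region is the projection, along the compact simplex, of a closed set of pairs (point, pmf).
-/
theorem isClosed_entropyRegion :
    IsClosed {r : ℝ × ℝ | ∃ p ∈ stdSimplex ℝ X,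
      r.1 ≤ entropy p f ∧ r.1 - r.2 ≤ condEntropy p f g} := by
  have h : IsClosed {s : (ℝ × ℝ) × stdSimplex ℝ X | s.1.1 ≤ entropy (s.2 : X → ℝ) f ∧
      s.1.1 - s.1.2 ≤ condEntropy (s.2 : X → ℝ) f g} := by
    have h1 : IsClosed {s : (ℝ × ℝ) × stdSimplex ℝ X | s.1.1 ≤ entropy (s.2 : X → ℝ) f} :=
      isClosed_le (by fun_prop)
        ((continuous_entropy f).comp (continuous_subtype_val.comp continuous_snd))
    have h2 : IsClosed {s : (ℝ × ℝ) × stdSimplex ℝ X |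
        s.1.1 - s.1.2 ≤ condEntropy (s.2 : X → ℝ) f g} :=
      isClosed_le (by fun_prop) ((continuous_condEntropy f g).comp continuous_snd)
    exact h1.inter h2
  convert isClosedMap_fst_of_compactSpace _ h using 1
  ext r
  constructor
  · rintro ⟨p, hp, h1, h2⟩
    exact ⟨(r, ⟨p, hp⟩), ⟨h1, h2⟩, rfl⟩
  · rintro ⟨⟨r, p⟩, ⟨h1, h2⟩, rfl⟩
    exact ⟨p, p.2, h1, h2⟩

/-- The single-letter region without a time-sharing variable is the one with a binary
time-sharing variable. -/
theorem entropyRegion_iff_timeSharing {R Rd : ℝ} (hRd : 0 ≤ Rd) :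
    (∃ p ∈ stdSimplex ℝ X, R ≤ entropy p f ∧ R - Rd ≤ condEntropy p f g) ↔
      ∃ k : ℕ, k ≤ 2 ∧ ∃ p ∈ stdSimplex ℝ (Fin k × X),
        R ≤ condEntropy p (fun qx => f qx.2) (fun qx => qx.1) ∧
        condMutualInfo p (fun qx => f qx.2) (fun qx => g qx.2) (fun qx => qx.1) ≤ Rd := by
  constructor
  · rintro ⟨p, hp, h1, h2⟩
    obtain ⟨p', hp', z, hz, hH⟩ := exists_conditioned_entropy_ge f g hp
    have hI := mutualInfo_eq_entropy_sub hp.1 f g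
    have hI' := mutualInfo_eq_zero_of_const hp' f g z hz
    -- The weight t of `p` spends the disturbance budget exactly, t I(Y;Z) = Rd, unless I(Y;Z)
    -- already fits. Since `p'` has zero mutual information, the rate is at least t (H(Y|Z) +
    -- I(Y;Z)) + (1-t) H(Y|Z) = H(Y|Z) + Rd.
    obtain ⟨t, ht0, ht1, hR, hD⟩ : ∃ t : ℝ, 0 ≤ t ∧ t ≤ 1 ∧
        R ≤ t * entropy p f + (1 - t) * entropy p' f ∧ t * mutualInfo p f g ≤ Rd := by
      by_cases hle : mutualInfo p f g ≤ Rd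
      · exact ⟨1, zero_le_one, le_rfl, by linarith, by linarith⟩
      push Not at hle
      have hpos := hRd.trans_lt hle
      have ht1 : Rd / mutualInfo p f g ≤ 1 := (div_le_one hpos).2 hle.le
      have ht : Rd / mutualInfo p f g * mutualInfo p f g = Rd := div_mul_cancel₀ _ hpos.ne'
      refine ⟨Rd / mutualInfo p f g, by positivity, ht1, ?_, ht.le⟩
      have h3 := mul_le_mul_of_nonneg_left hH (sub_nonneg.2 ht1)
      have h4 : entropy p f = condEntropy p f g + mutualInfo p f g := by linarith
      rw [h4, mul_add, ht]
      linarith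
    have hw : ![t, 1 - t] ∈ stdSimplex ℝ (Fin 2) := by
      refine ⟨fun i => ?_, by simp⟩
      fin_cases i <;> simp [ht0, ht1]
    have hr : ∀ q, (![p, p'] : Fin 2 → X → ℝ) q ∈ stdSimplex ℝ X := by
      intro q
      fin_cases q
      · exact hp
      · exact hp'
    refine ⟨2, le_rfl, _, mixture_mem_stdSimplex hw hr, ?_, ?_⟩
    · rw [condEntropy_mixture hr]
      simpa using hR
    · rw [condMutualInfo_mixture hr]
      simpa [hI'] using hD
  -- Conversely, take the marginal of X: H(Y|Q) ≤ H(Y), and H(Y|Q) - I(Y;Z|Q) = H(Y|Z,Q) ≤ H(Y|Z).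
  · rintro ⟨k, -, p, hp, h1, h2⟩
    refine ⟨law p Prod.snd, law_mem_stdSimplex hp _, ?_, ?_⟩
    · rw [entropy_law]
      exact h1.trans (condEntropy_le_entropy hp _ _)
    · rw [condEntropy_law]
      have h3 := condEntropy_sub_condMutualInfo hp.1 (fun qx : Fin k × X => f qx.2)
        (fun qx => g qx.2) (fun qx => qx.1)
      have h4 := condEntropy_pair_le hp (fun qx : Fin k × X => f qx.2)
        (fun qx => g qx.2) (fun qx => qx.1)
      linarith

end Regions

/-! ### Codes over a deterministic channel -/

section DeterministicCode

variable {X Y Z : Type*} [Fintype Y] [Fintype Z] {N n : ℕ}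

open Classical in
theorem prob_jointPMF_deterministic (f : X → Y) (g : X → Z) (c : Code X Y N n)
    (E : Fin N × (Fin n → Y × Z) → Prop) :
    prob (c.jointPMF (Channel.deterministic f g)) E =
      ∑ m, if E (m, fun i => (f (c.enc m i), g (c.enc m i))) then 1 / (N : ℝ) else 0 := by
  have h : ∀ m (s : Fin n → Y × Z), c.jointPMF (Channel.deterministic f g) (m, s) =
      if s = fun i => (f (c.enc m i), g (c.enc m i)) then 1 / (N : ℝ) else 0 := by
    intro m s
    simp only [Code.jointPMF, Channel.deterministic]
    split_ifs with hs
    · simp [hs]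
    · obtain ⟨i, hi⟩ := Function.ne_iff.1 hs
      rw [Finset.prod_eq_zero (Finset.mem_univ i) (by simp [hi]), mul_zero]
  rw [prob, Finset.sum_filter, Fintype.sum_prod_type]
  refine Finset.sum_congr rfl fun m _ => ?_
  rw [Finset.sum_eq_single fun i => (f (c.enc m i), g (c.enc m i))]
  · simp [h]
  · intro s _ hs
    simp [h, hs]
  · simp

theorem law_jointPMF_deterministic {α : Type*} (f : X → Y) (g : X → Z) (c : Code X Y N n)
    (A : Fin N × (Fin n → Y × Z) → α) :
    law (c.jointPMF (Channel.deterministic f g)) A =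
      law (fun _ => 1 / (N : ℝ)) fun m => A (m, fun i => (f (c.enc m i), g (c.enc m i))) := by
  classical
  funext a
  rw [law, prob_jointPMF_deterministic, law_eq_sum_ite]

/-- The side sequence is a function of the codeword, so the mutual information is its own entropy.
-/
theorem disturbance_deterministic [Fintype X] (f : X → Y) (g : X → Z) (c : Code X Y N n) :
    c.disturbance (Channel.deterministic f g) =
      entropy (fun _ => 1 / (N : ℝ)) fun m i => g (c.enc m i) := by
  rw [← mutualInfo_comp_right (fun _ => by positivity) c.enc fun x i => g (x i)]
  simp only [Code.disturbance, mutualInfo, law_jointPMF_deterministic]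

open Classical in
theorem errorProb_deterministic (f : X → Y) (g : X → Z) (c : Code X Y N n) :
    c.errorProb (Channel.deterministic f g) =
      ∑ m, if c.dec (fun i => f (c.enc m i)) ≠ m then 1 / (N : ℝ) else 0 := by
  rw [Code.errorProb, prob_jointPMF_deterministic]
  refine Finset.sum_congr rfl fun m _ => ?_
  congr

end DeterministicCode

/-! ### Uniform laws and entropy under domination -/

section Uniform

variable {M α β : Type*} [Fintype M] [Fintype α]

open Classical in
/-- The uniform pmf on a finite set. -/
def uniformOn (G : Finset M) (m : M) : ℝ := if m ∈ G then (G.card : ℝ)⁻¹ else 0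

theorem uniformOn_mem_stdSimplex {G : Finset M} (hG : G.Nonempty) :
    uniformOn G ∈ stdSimplex ℝ M := by
  classical
  refine ⟨fun m => by unfold uniformOn; split_ifs <;> positivity, ?_⟩
  have := hG.card_pos
  simp only [uniformOn, Finset.sum_ite_mem, Finset.univ_inter, Finset.sum_const, nsmul_eq_mul]
  exact mul_inv_cancel₀ (by positivity)

theorem entropy_uniformOn {G : Finset M} (hG : G.Nonempty) {A : M → α} (hA : Set.InjOn A G) :
    entropy (uniformOn G) A = Real.logb 2 G.card := by
  classical
  have h : ∀ m ∈ G, law (uniformOn G) A (A m) = (G.card : ℝ)⁻¹ := by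
    intro m hm
    rw [law_eq_sum_ite, Finset.sum_eq_single m]
    · simp [uniformOn, hm]
    · intro m' _ hne
      by_cases hm' : m' ∈ G
      · exact if_neg fun h => hne (hA hm' hm h)
      · simp [uniformOn, hm']
    · simp
  have h2 : ∀ m, uniformOn G m * Real.logb 2 (law (uniformOn G) A (A m)) =
      uniformOn G m * -Real.logb 2 G.card := by
    intro m
    by_cases hm : m ∈ G
    · rw [h m hm, Real.logb_inv]
    · simp [uniformOn, hm]
  rw [entropy_eq_sum]
  simp only [h2, ← Finset.sum_mul, (uniformOn_mem_stdSimplex hG).2]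
  ring

/-- Bound H(p') by the cross entropy against the law under `p`; since -log of a probability is
nonnegative, t p' ≤ p then gives the claim. It serves to transfer the disturbance to the correctly
decoded messages. -/
theorem mul_entropy_le_of_le {p p' : M → ℝ} (hp : p ∈ stdSimplex ℝ M) (hp' : p' ∈ stdSimplex ℝ M)
    {t : ℝ} (ht : 0 < t) (h : ∀ m, t * p' m ≤ p m) (A : M → α) :
    t * entropy p' A ≤ entropy p A := by
  have h1 := entropy_le_crossEntropy hp' A (law p A) (law_nonneg hp.1 A)
    (by rw [sum_law, hp.2]) fun m hm => by
      have h2 : 0 < p' m := lt_of_le_of_ne (hp'.1 m) hm.symm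
      exact law_pos hp.1 A ((mul_pos ht h2).trans_le (h m)).ne'
  refine (mul_le_mul_of_nonneg_left h1 ht.le).trans ?_
  rw [entropy_eq_sum, ← Finset.sum_neg_distrib, ← Finset.sum_neg_distrib, Finset.mul_sum]
  refine Finset.sum_le_sum fun m _ => ?_
  have h3 : Real.logb 2 (law p A (A m)) ≤ 0 :=
    Real.logb_nonpos (by norm_num) (law_nonneg hp.1 _ _) (law_le_one hp _ _)
  nlinarith [h m]

end Uniform

/-! ### Single-letterization -/

section SingleLetter

variable {M X Y Z : Type*} [Fintype M] [Fintype X] [Fintype Y] [Fintype Z] {n : ℕ}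

/-- The law of a uniformly chosen letter of a random sequence. -/
def averageLetterLaw (p : M → ℝ) (x : M → Fin n → X) : X → ℝ :=
  law (fun im : Fin n × M => (1 / (n : ℝ)) * p im.2) fun im => x im.2 im.1

theorem averageLetterLaw_mem_stdSimplex (hn : 0 < n) {p : M → ℝ} (hp : p ∈ stdSimplex ℝ M)
    (x : M → Fin n → X) : averageLetterLaw p x ∈ stdSimplex ℝ X := by
  refine law_mem_stdSimplex (mixture_mem_stdSimplex (w := fun _ : Fin n => 1 / (n : ℝ))
    (r := fun _ => p) ⟨fun _ => by positivity, ?_⟩ fun _ => hp) _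
  simp [hn.ne']

/-- The conditional entropy of memoryless images of a sequence is at most `n` times that of the
images of the average letter. -/
theorem condEntropy_seq_le (hn : 0 < n) {p : M → ℝ} (hp : p ∈ stdSimplex ℝ M)
    (x : M → Fin n → X) (f : X → Y) (g : X → Z) :
    condEntropy p (fun m i => f (x m i)) (fun m i => g (x m i)) ≤
      n * condEntropy (averageLetterLaw p x) f g := by
  have hn' : (0 : ℝ) < n := by exact_mod_cast hn
  have hP := averageLetterLaw_mem_stdSimplex hn hp x
  set P := averageLetterLaw p x with hPdef
  -- The conditional law of Y given Z for the average letter. The product of n copies is a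
  -- sub-kernel on sequences, and its cross entropy is exactly n times the single-letter conditional
  -- entropy, because the logarithm turns the product into a sum over positions.
  set κ : Y → Z → ℝ := fun y z => law P (fun x => (f x, g x)) (y, z) / law P g z with hκ
  have hκ0 : ∀ y z, 0 ≤ κ y z := fun y z => div_nonneg (law_nonneg hP.1 _ _) (law_nonneg hP.1 _ _)
  have hκ1 : ∀ m i, p m ≠ 0 → 0 < κ (f (x m i)) (g (x m i)) := by
    intro m i hm
    have h1 : P (x m i) ≠ 0 := by
      refine (law_pos (p := fun im : Fin n × M => (1 / (n : ℝ)) * p im.2)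
        (fun im => mul_nonneg (by positivity) (hp.1 _)) (fun im => x im.2 im.1)
        (ω := (i, m)) ?_).ne'
      exact mul_ne_zero (by positivity) hm
    exact div_pos (law_pos hP.1 (fun x => (f x, g x)) h1) (law_pos hP.1 g h1)
  have h := condEntropy_le_crossEntropy hp (fun m i => f (x m i)) (fun m i => g (x m i))
    (fun y z => ∏ i, κ (y i) (z i)) (fun y z => Finset.prod_nonneg fun i _ => hκ0 _ _)
    (fun z => by
      rw [← Fintype.piFinset_univ, ← Finset.prod_univ_sum (fun _ => Finset.univ)
        (fun i y => κ y (z i))]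
      exact Finset.prod_le_one (fun i _ => Finset.sum_nonneg fun y _ => hκ0 _ _)
        fun i _ => sum_law_div_le_one P f g (z i))
    (fun m hm => Finset.prod_pos fun i _ => hκ1 m i hm)
  refine h.trans_eq ?_
  have hs : ∑ a, P a * Real.logb 2 (κ (f a) (g a)) = ∑ im : Fin n × M,
      1 / (n : ℝ) * p im.2 * Real.logb 2 (κ (f (x im.2 im.1)) (g (x im.2 im.1))) :=
    sum_law_mul _ _ fun a => Real.logb 2 (κ (f a) (g a))
  rw [condEntropy_eq_sum, mul_neg]
  change _ = -(n * ∑ a, P a * Real.logb 2 (κ (f a) (g a)))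
  rw [hs, Fintype.sum_prod_type_right, Finset.mul_sum]
  congr 1
  refine Finset.sum_congr rfl fun m _ => ?_
  by_cases hm : p m = 0
  · simp [hm]
  rw [Real.logb_prod _ _ fun i _ => (hκ1 m i hm).ne', Finset.mul_sum, Finset.mul_sum]
  refine Finset.sum_congr rfl fun i _ => ?_
  field_simp

theorem entropy_seq_le (hn : 0 < n) {p : M → ℝ} (hp : p ∈ stdSimplex ℝ M)
    (x : M → Fin n → X) (f : X → Y) :
    entropy p (fun m i => f (x m i)) ≤ n * entropy (averageLetterLaw p x) f := by
  rw [entropy_eq_condEntropy_const hp _ (fun _ : Fin n => ()),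
    entropy_eq_condEntropy_const (averageLetterLaw_mem_stdSimplex hn hp x) f ()]
  exact condEntropy_seq_le hn hp x f fun _ => ()

end SingleLetter

/-! ### The converse -/

section Converse

variable {X Y Z : Type*} [Fintype X] [Fintype Y] [Fintype Z]

/-- The pmf is the average letter law when the message is uniform on the correctly decoded set `G`.
There Yⁿ, hence also (Yⁿ,Zⁿ), is injective in the message, so H(Yⁿ|Zⁿ) = log |G| - H(Zⁿ) with |G| ≥
N (1-e). -/
theorem converse_of_code (f : X → Y) (g : X → Z) {N n : ℕ} (hN : 0 < N) (hn : 0 < n)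
    (c : Code X Y N n) {e : ℝ} (he : c.errorProb (Channel.deterministic f g) ≤ e) (he1 : e < 1) :
    ∃ p ∈ stdSimplex ℝ X, Real.logb 2 N + Real.logb 2 (1 - e) ≤ n * entropy p f ∧
      Real.logb 2 N + Real.logb 2 (1 - e) - c.disturbance (Channel.deterministic f g) / (1 - e) ≤
        n * condEntropy p f g := by
  classical
  have hN' : (0 : ℝ) < N := by exact_mod_cast hN
  have he2 : 0 < 1 - e := by linarith
  set G : Finset (Fin N) := Finset.univ.filter fun m => c.dec (fun i => f (c.enc m i)) = m with hG
  have hcard : N * (1 - e) ≤ G.card := by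
    have h2 : c.errorProb (Channel.deterministic f g) = 1 - G.card / N := by
      have h1 : ∀ m : Fin N, (if c.dec (fun i => f (c.enc m i)) ≠ m then 1 / (N : ℝ) else 0) =
          1 / N - if m ∈ G then 1 / (N : ℝ) else 0 := by
        intro m
        by_cases hm : c.dec (fun i => f (c.enc m i)) = m <;> simp [hG, hm]
      rw [errorProb_deterministic]
      simp only [h1, Finset.sum_sub_distrib, Finset.sum_ite_mem, Finset.univ_inter,
        Finset.sum_const, Finset.card_univ, Fintype.card_fin, nsmul_eq_mul]
      field_simp
    rw [h2] at he
    have h3 : 1 - e ≤ G.card / N := by linarith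
    rw [le_div_iff₀ hN'] at h3
    linarith
  have hG0 : (0 : ℝ) < G.card := (mul_pos hN' he2).trans_le hcard
  have hGne : G.Nonempty := Finset.card_pos.1 (by exact_mod_cast hG0)
  have hp := uniformOn_mem_stdSimplex hGne
  have hlog : Real.logb 2 N + Real.logb 2 (1 - e) ≤ Real.logb 2 G.card := by
    rw [← Real.logb_mul hN'.ne' he2.ne']
    exact Real.logb_le_logb_of_le (by norm_num) (by positivity) hcard
  have hinj : Set.InjOn (fun m i => f (c.enc m i)) (G : Set (Fin N)) := by
    intro m hm m' hm' h
    simp only [hG, Finset.coe_filter, Finset.mem_univ, true_and, Set.mem_ofPred_eq] at hm hm'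
    dsimp only at h
    rw [← hm, ← hm', h]
  have hinj2 : Set.InjOn (fun m => ((fun i => f (c.enc m i)), fun i => g (c.enc m i)))
      (G : Set (Fin N)) := fun m hm m' hm' h => hinj hm hm' (congrArg Prod.fst h)
  have hu : (fun _ => 1 / (N : ℝ)) ∈ stdSimplex ℝ (Fin N) :=
    ⟨fun _ => by positivity, by simp [hN'.ne']⟩
  have hdist : entropy (uniformOn G) (fun m i => g (c.enc m i)) ≤
      c.disturbance (Channel.deterministic f g) / (1 - e) := by
    -- Since |G| ≥ N (1-e), the uniform pmf on all messages dominates (1-e) times the uniform pmf on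
    -- `G`.
    rw [le_div_iff₀ he2, mul_comm, disturbance_deterministic]
    refine mul_entropy_le_of_le hu hp he2 (fun m => ?_) _
    unfold uniformOn
    split_ifs
    · rw [← div_eq_mul_inv, div_le_div_iff₀ hG0 hN']
      linarith
    · simp
  refine ⟨averageLetterLaw (uniformOn G) c.enc, averageLetterLaw_mem_stdSimplex hn hp c.enc, ?_, ?_⟩
  · exact (hlog.trans_eq (entropy_uniformOn hGne hinj).symm).trans (entropy_seq_le hn hp c.enc f)
  · refine le_trans ?_ (condEntropy_seq_le hn hp c.enc f g)
    rw [condEntropy_eq_entropy_sub hp.1, entropy_uniformOn hGne hinj2]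
    linarith

theorem logb_numMessages_ge (R : ℝ) (n : ℕ) : n * R ≤ Real.logb 2 (numMessages R n) := by
  have h : (2 : ℝ) ^ ((n : ℝ) * R) ≤ numMessages R n := Nat.le_ceil _
  have h0 : (0 : ℝ) < 2 ^ ((n : ℝ) * R) := by positivity
  rwa [Real.le_logb_iff_rpow_le (by norm_num) (h0.trans_le h)]

theorem numMessages_pos (R : ℝ) (n : ℕ) : 0 < numMessages R n :=
  Nat.ceil_pos.2 (by positivity)

theorem converse (f : X → Y) (g : X → Z) {R Rd : ℝ}
    (h : Achievable (Channel.deterministic f g) R Rd) :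
    ∃ p ∈ stdSimplex ℝ X, R ≤ entropy p f ∧ R - Rd ≤ condEntropy p f g := by
  obtain ⟨-, hRd, c, herr, hdist⟩ := h
  have key : ∀ δ : ℝ, 0 < δ → ∃ p ∈ stdSimplex ℝ X,
      R - δ ≤ entropy p f ∧ R - δ - (Rd + δ) ≤ condEntropy p f g := by
    intro δ hδ
    have hpos : 0 < Rd + δ := by linarith
    -- The bound 1/2 gives log (1-e) ≥ -1, absorbed by n δ > 1. The other bound gives Rd + δ/2 ≤ (Rd
    -- + δ)(1-e), which absorbs the division by 1-e.
    have hε : (0 : ℝ) < min (1 / 2) (δ / 2 / (Rd + δ)) := by positivity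
    have h1 := herr.eventually_lt_const hε
    have h2 := Filter.eventually_lt_of_limsup_lt
      (hdist.trans_lt (EReal.coe_lt_coe_iff.2 (show Rd < Rd + δ / 2 by linarith)))
    have h3 := tendsto_one_div_atTop_nhds_zero_nat.eventually_lt_const hδ
    obtain ⟨n, ⟨⟨hn1, hn2⟩, hn3⟩, hn4⟩ :=
      (((h1.and h2).and h3).and (Filter.eventually_gt_atTop 0)).exists
    rw [EReal.coe_lt_coe_iff] at hn2
    have hn' : (0 : ℝ) < n := by exact_mod_cast hn4
    set e := min (1 / 2) (δ / 2 / (Rd + δ))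
    have he1 : e ≤ 1 / 2 := min_le_left _ _
    have he2 : e * (Rd + δ) ≤ δ / 2 := by
      rw [← le_div_iff₀ hpos]; exact min_le_right _ _
    obtain ⟨p, hp, hpR, hpD⟩ := converse_of_code f g (numMessages_pos R n) hn4 (c n) hn1.le
      (by linarith)
    have hlog : -1 ≤ Real.logb 2 (1 - e) := by
      rw [Real.le_logb_iff_rpow_le (by norm_num) (by linarith), Real.rpow_neg_one]
      linarith
    have hN := logb_numMessages_ge R n
    have hδn : 1 < n * δ := by
      rw [one_div, inv_lt_iff_one_lt_mul₀ hn'] at hn3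
      linarith
    have hI : (c n).disturbance (Channel.deterministic f g) / (1 - e) ≤ n * (Rd + δ) := by
      rw [div_le_iff₀ (by linarith)]
      rw [one_div, inv_mul_lt_iff₀ hn'] at hn2
      have : (n : ℝ) * (Rd + δ / 2) ≤ n * ((Rd + δ) * (1 - e)) := by
        gcongr
        linarith
      linarith
    refine ⟨p, hp, le_of_mul_le_mul_left ?_ hn', le_of_mul_le_mul_left ?_ hn'⟩ <;> linarith
  have hlim : Filter.Tendsto (fun δ : ℝ => (R - δ, Rd + δ)) (𝓝[>] 0) (𝓝 (R, Rd)) := by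
    have : Continuous fun δ : ℝ => (R - δ, Rd + δ) := by fun_prop
    simpa using (this.tendsto 0).mono_left nhdsWithin_le_nhds
  exact (isClosed_entropyRegion f g).mem_of_tendsto hlim
    (Filter.eventually_of_mem self_mem_nhdsWithin fun δ hδ => key δ hδ)

end Converse

/-! ### Product laws and typicality -/

section ProductLaw

variable {X α β : Type*} [Fintype X]

/-- The law of `n` independent letters with pmf `p`. -/
def prodPMF (p : X → ℝ) (n : ℕ) (x : Fin n → X) : ℝ := ∏ i, p (x i)

theorem prodPMF_mem_stdSimplex {p : X → ℝ} (hp : p ∈ stdSimplex ℝ X) (n : ℕ) :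
    prodPMF p n ∈ stdSimplex ℝ (Fin n → X) := by
  classical
  refine ⟨fun x => Finset.prod_nonneg fun i _ => hp.1 _, ?_⟩
  simp only [prodPMF]
  rw [← Fintype.piFinset_univ, ← Finset.prod_univ_sum (fun _ => Finset.univ) (fun _ => p)]
  simp [hp.2]

theorem law_prodPMF (p : X → ℝ) {n : ℕ} (f : X → α) (y : Fin n → α) :
    law (prodPMF p n) (fun x i => f (x i)) y = ∏ i, law p f (y i) := by
  classical
  simp only [law_eq_sum_ite, prodPMF]
  rw [Finset.prod_univ_sum (fun _ => Finset.univ), Fintype.piFinset_univ]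
  refine Finset.sum_congr rfl fun x _ => ?_
  rw [Finset.prod_ite_zero]
  simp [funext_iff]

/-- The variance of a sum of independent centred letters is additive: when the first letter is split
off, the cross term vanishes because `h` has mean zero. -/
theorem sum_prodPMF_mul_sq {p h : X → ℝ} (hp : p ∈ stdSimplex ℝ X) (h0 : ∑ x, p x * h x = 0)
    (n : ℕ) :
    ∑ x, prodPMF p n x * (∑ i, h (x i)) ^ 2 = n * ∑ x, p x * h x ^ 2 := by
  induction n with
  | zero => simp
  | succ n ih =>
    have h1 : ∀ a (x : Fin n → X), prodPMF p (n + 1) (Fin.cons a x) *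
        (∑ i, h ((Fin.cons a x : Fin (n + 1) → X) i)) ^ 2 =
        p a * h a ^ 2 * prodPMF p n x + p a * h a * (2 * (prodPMF p n x * ∑ i, h (x i))) +
          p a * (prodPMF p n x * (∑ i, h (x i)) ^ 2) := by
      intro a x
      simp only [prodPMF, Fin.prod_univ_succ, Fin.sum_univ_succ, Fin.cons_zero, Fin.cons_succ]
      ring
    have h2 : ∀ F : (Fin (n + 1) → X) → ℝ,
        ∑ x, F x = ∑ a, ∑ x : Fin n → X, F (Fin.cons a x) := by
      intro F
      rw [← (Fin.consEquiv fun _ : Fin (n + 1) => X).sum_comp, Fintype.sum_prod_type]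
      rfl
    simp only [h2, h1, Finset.sum_add_distrib, ← Finset.mul_sum, ← Finset.sum_mul,
      ih, (prodPMF_mem_stdSimplex hp n).2, h0, hp.2]
    push_cast
    ring

open Classical in
/-- Chebyshev's inequality for sums of centred independent letters. -/
theorem chebyshev_prodPMF {p h : X → ℝ} (hp : p ∈ stdSimplex ℝ X) (h0 : ∑ x, p x * h x = 0)
    {n : ℕ} (hn : 0 < n) {ε : ℝ} (hε : 0 < ε) :
    ∑ x with n * ε < |∑ i, h (x i)|, prodPMF p n x ≤ (∑ x, p x * h x ^ 2) / ε ^ 2 / n := by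
  have hn' : (0 : ℝ) < n := by exact_mod_cast hn
  have hP := prodPMF_mem_stdSimplex hp n
  rw [div_div, le_div_iff₀ (by positivity)]
  have h1 : (∑ x with n * ε < |∑ i, h (x i)|, prodPMF p n x) * (n * ε) ^ 2 ≤
      n * ∑ x, p x * h x ^ 2 := by
    rw [← sum_prodPMF_mul_sq hp h0, Finset.sum_mul]
    refine (Finset.sum_le_sum fun x hx => ?_).trans (Finset.sum_le_sum_of_subset_of_nonneg
      (Finset.filter_subset _ _) fun x _ _ => mul_nonneg (hP.1 x) (sq_nonneg _))
    rw [Finset.mem_filter] at hx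
    refine mul_le_mul_of_nonneg_left ?_ (hP.1 x)
    rw [← sq_abs (∑ i, h (x i))]
    exact pow_le_pow_left₀ (by positivity) hx.2.le 2
  refine le_of_mul_le_mul_left ?_ hn'
  linarith

variable [Fintype α]

open Classical in
/-- The asymptotic equipartition property. -/
theorem aep {p : X → ℝ} (hp : p ∈ stdSimplex ℝ X) (f : X → α) {ε η : ℝ} (hε : 0 < ε) (hη : 0 < η) :
    ∀ᶠ n : ℕ in Filter.atTop, ∑ x with ¬ (prodPMF p n x ≠ 0 →
      |Real.logb 2 (law (prodPMF p n) (fun x i => f (x i)) (fun i => f (x i))) + n * entropy p f| ≤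
        n * ε), prodPMF p n x ≤ η := by
  -- The centred log-likelihood of one letter. Sequences of mass zero are excluded from the bad
  -- event, so the logarithm of the product law splits into a sum over letters.
  set h : X → ℝ := fun x => Real.logb 2 (law p f (f x)) + entropy p f with hh
  have h0 : ∑ x, p x * h x = 0 := by
    simp only [hh, mul_add, Finset.sum_add_distrib, ← Finset.sum_mul, hp.2, entropy_eq_sum]
    ring
  have hlim := (tendsto_const_div_atTop_nhds_zero_nat
    ((∑ x, p x * h x ^ 2) / ε ^ 2)).eventually_le_const hη
  filter_upwards [hlim, Filter.eventually_gt_atTop 0] with n hn hn0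
  refine le_trans (Finset.sum_le_sum_of_subset_of_nonneg (fun x hx => ?_) fun x _ _ =>
    (prodPMF_mem_stdSimplex hp n).1 x) ((chebyshev_prodPMF hp h0 hn0 hε).trans hn)
  simp only [Finset.mem_filter, Finset.mem_univ, true_and, Classical.not_imp, not_le] at hx ⊢
  have hsum : ∑ i, h (x i) = Real.logb 2 (law (prodPMF p n) (fun x i => f (x i))
      (fun i => f (x i))) + n * entropy p f := by
    rw [law_prodPMF, Real.logb_prod]
    · simp [hh, Finset.sum_add_distrib]
    · intro i hi
      exact (law_pos hp.1 f (Finset.prod_ne_zero_iff.1 hx.1 i hi)).ne'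
  rw [hsum]
  exact hx.2

end ProductLaw

/-! ### Greedy covering -/

section Covering

variable {Ω α β : Type*} [Fintype Ω]

/-- If every value in the image has probability at most u, this turns the mass of `T` into a lower
bound for the number of values of `A` on `T`. -/
theorem sum_le_sum_image_law [DecidableEq α] {P : Ω → ℝ} (hP : ∀ ω, 0 ≤ P ω) (A : Ω → α) (T : Finset Ω) :
    ∑ ω ∈ T, P ω ≤ ∑ a ∈ T.image A, law P A a := by
  rw [← Finset.sum_fiberwise_of_maps_to (g := A) (t := T.image A)
    fun ω hω => Finset.mem_image_of_mem A hω]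
  refine Finset.sum_le_sum fun a _ => ?_
  rw [law, prob]
  exact Finset.sum_le_sum_of_subset_of_nonneg (fun ω => by simp) fun ω _ _ => hP ω

variable [Fintype β] [DecidableEq α] [DecidableEq β]

/-- Greedy covering: `K` values of `B` can be chosen so that many values of `A` are jointly
typical with one of them. -/
theorem exists_cover {P : Ω → ℝ} (hP : P ∈ stdSimplex ℝ Ω) (A : Ω → α) (B : Ω → β) (T : Finset Ω)
    (hT : 3 / 4 ≤ ∑ ω ∈ T, P ω) {u v w : ℝ} (hu0 : 0 < u) (hv0 : 0 < v)
    (hu : ∀ ω ∈ T, law P A (A ω) ≤ u)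
    (hv : ∀ ω ∈ T, law P (fun ω => (A ω, B ω)) (A ω, B ω) ≤ v)
    (hw : ∀ ω ∈ T, w ≤ law P B (B ω)) (K : ℕ) :
    ∃ S : Finset β, S.card ≤ K ∧
      min (1 / (2 * u)) (K * (w / (4 * v))) ≤ ((T.filter fun ω => B ω ∈ S).image A).card := by
  induction K with
  | zero => exact ⟨∅, by simp⟩
  | succ K ih =>
    obtain ⟨S, hS, hC⟩ := ih
    set C := (T.filter fun ω => B ω ∈ S).image A with hCdef
    by_cases hlarge : 1 / (2 * u) ≤ C.card
    · exact ⟨S, by omega, (min_le_left _ _).trans hlarge⟩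
    push Not at hlarge
    have hK : K * (w / (4 * v)) ≤ C.card := (min_le_iff.1 hC).resolve_left (not_le.2 hlarge)
    -- The covered values carry mass less than 1/2, since there are fewer than 1/(2u) of them; so
    -- the uncovered typical outcomes keep mass at least 3/4 - 1/2.
    set U := T.filter fun ω => A ω ∉ C with hU
    have hUsum : 1 / 4 ≤ ∑ ω ∈ U, P ω := by
      have h1 : ∑ ω ∈ T with A ω ∈ C, P ω ≤ C.card * u := by
        refine (sum_le_sum_image_law hP.1 A _).trans ?_
        refine (Finset.sum_le_card_nsmul _ _ u fun a ha => ?_).trans ?_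
        · obtain ⟨ω, hω, rfl⟩ := Finset.mem_image.1 ha
          exact hu ω (Finset.mem_filter.1 hω).1
        · rw [nsmul_eq_mul]
          refine mul_le_mul_of_nonneg_right (Nat.cast_le.2 (Finset.card_le_card ?_)) hu0.le
          intro a ha
          obtain ⟨ω, hω, rfl⟩ := Finset.mem_image.1 ha
          exact (Finset.mem_filter.1 hω).2
      have h2 := Finset.sum_filter_add_sum_filter_not T (fun ω => A ω ∈ C) P
      rw [lt_div_iff₀ (by positivity)] at hlarge
      linarith
    have hUne : (U.image B).Nonempty := by
      rw [Finset.image_nonempty]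
      by_contra h
      rw [Finset.not_nonempty_iff_eq_empty] at h
      rw [h, Finset.sum_empty] at hUsum
      norm_num at hUsum
    have hcard : (U.image B).card * w ≤ 1 := by
      rw [← (law_mem_stdSimplex hP B).2, ← nsmul_eq_mul]
      refine (Finset.card_nsmul_le_sum _ (law P B) w fun b hb => ?_).trans
        (Finset.sum_le_sum_of_subset_of_nonneg (Finset.subset_univ _) fun b _ _ =>
          law_nonneg hP.1 B b)
      obtain ⟨ω, hω, rfl⟩ := Finset.mem_image.1 hb
      exact hw ω (Finset.mem_filter.1 hω).1
    -- Pigeonhole: `card * w ≤ 1` for the values of `B` on `U`, which share mass at least 1/4. As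
    -- each pair has mass at most v, the chosen b contributes at least w/(4v) new values of `A`.
    obtain ⟨b, -, hb⟩ : ∃ b ∈ U.image B, w / 4 ≤ ∑ ω ∈ U with B ω = b, P ω := by
      refine Finset.exists_le_of_sum_le hUne ?_
      rw [Finset.sum_fiberwise_of_maps_to fun ω hω => Finset.mem_image_of_mem B hω,
        Finset.sum_const, nsmul_eq_mul]
      linarith
    set D := (U.filter fun ω => B ω = b).image A with hD
    have hDcard : w / (4 * v) ≤ D.card := by
      have h1 : ∑ ω ∈ U with B ω = b, P ω ≤ D.card * v := by
        refine (sum_le_sum_image_law hP.1 (fun ω => (A ω, B ω)) _).trans ?_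
        refine (Finset.sum_le_card_nsmul _ _ v fun ab hab => ?_).trans ?_
        · obtain ⟨ω, hω, rfl⟩ := Finset.mem_image.1 hab
          exact hv ω (Finset.mem_filter.1 (Finset.mem_filter.1 hω).1).1
        · rw [nsmul_eq_mul]
          refine mul_le_mul_of_nonneg_right (Nat.cast_le.2 ?_) hv0.le
          refine (Finset.card_le_card (t := D.image fun a => (a, b)) fun ab hab => ?_).trans
            Finset.card_image_le
          obtain ⟨ω, hω, rfl⟩ := Finset.mem_image.1 hab
          refine Finset.mem_image.2 ⟨A ω, Finset.mem_image_of_mem A hω, ?_⟩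
          rw [(Finset.mem_filter.1 hω).2]
      rw [div_le_iff₀ (by positivity)]
      linarith
    refine ⟨insert b S, (Finset.card_insert_le _ _).trans (by omega), (min_le_right _ _).trans ?_⟩
    have hdisj : Disjoint C D := by
      rw [Finset.disjoint_right]
      intro a ha
      obtain ⟨ω, hω, rfl⟩ := Finset.mem_image.1 ha
      exact (Finset.mem_filter.1 (Finset.mem_filter.1 hω).1).2
    have hsub : C ∪ D ⊆ (T.filter fun ω => B ω ∈ insert b S).image A := by
      classical
      rw [hCdef, hD, ← Finset.image_union]
      refine Finset.image_subset_image fun ω hω => ?_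
      simp only [Finset.mem_union, Finset.mem_filter, hU, Finset.mem_insert] at hω ⊢
      tauto
    have hfin := Finset.card_le_card hsub
    rw [Finset.card_union_of_disjoint hdisj] at hfin
    have hfin' : (C.card : ℝ) + D.card ≤
        ((T.filter fun ω => B ω ∈ insert b S).image A).card := by exact_mod_cast hfin
    push_cast
    linarith

end Covering

/-! ### Achievability and the region -/

section Achievability

variable {X Y Z : Type*} [Fintype X] [Fintype Y] [Fintype Z]

open Classical in
/-- Distinct receiver sequences give a zero-error code, whose disturbance is controlled by the
number of side receiver sequences. -/
theorem exists_code_of_cover (f : X → Y) (g : X → Z) {N n K : ℕ} (hN : 0 < N) (hK : 0 < K)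
    (T : Finset (Fin n → X)) (S : Finset (Fin n → Z)) (hS : S.card ≤ K)
    (hT : N ≤ ((T.filter fun x => (fun i => g (x i)) ∈ S).image fun x i => f (x i)).card) :
    ∃ c : Code X Y N n, c.errorProb (Channel.deterministic f g) = 0 ∧
      c.disturbance (Channel.deterministic f g) ≤ Real.logb 2 K := by
  set C := (T.filter fun x => (fun i => g (x i)) ∈ S).image fun x i => f (x i) with hC
  have hlift : ∀ y : C, ∃ x : Fin n → X, (fun i => g (x i)) ∈ S ∧ (fun i => f (x i)) = y := by
    rintro ⟨y, hy⟩
    obtain ⟨x, hx, rfl⟩ := Finset.mem_image.1 hy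
    exact ⟨x, (Finset.mem_filter.1 hx).2, rfl⟩
  choose x hxg hxf using hlift
  let e : Fin N → C := fun m => C.equivFin.symm (Fin.castLE hT m)
  have he : Function.Injective fun m => (e m : Fin n → Y) :=
    Subtype.val_injective.comp (C.equivFin.symm.injective.comp (Fin.castLE_injective hT))
  have : Nonempty (Fin N) := ⟨⟨0, hN⟩⟩
  refine ⟨⟨fun m => x (e m), Function.invFun fun m => (e m : Fin n → Y)⟩, ?_, ?_⟩
  · rw [errorProb_deterministic]
    refine Finset.sum_eq_zero fun m _ => if_neg ?_
    rw [not_not]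
    dsimp only
    rw [hxf]
    exact Function.leftInverse_invFun he m
  · rw [disturbance_deterministic]
    have hN' : (N : ℝ) ≠ 0 := by exact_mod_cast hN.ne'
    exact entropy_le_logb_card ⟨fun _ => by positivity, by simp [hN']⟩ _ S
      (fun m => hxg (e m)) hS hK

/-- Block lengths without a good code get an arbitrary one, which does not affect the limits.
Rounding up the number of side sequences costs at most one bit, that is 1/n per letter. -/
theorem achievable_of_eventually_exists_code [Nonempty X] (f : X → Y) (g : X → Z) {R Rd : ℝ}
    (hR : 0 ≤ R) (hRd : 0 ≤ Rd)
    (h : ∀ᶠ n : ℕ in Filter.atTop, ∃ c : Code X Y (numMessages R n) n,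
      c.errorProb (Channel.deterministic f g) = 0 ∧
      c.disturbance (Channel.deterministic f g) ≤ Real.logb 2 (numMessages Rd n)) :
    Achievable (Channel.deterministic f g) R Rd := by
  classical
  have hex : ∀ n : ℕ, ∃ c : Code X Y (numMessages R n) n,
      (∃ c : Code X Y (numMessages R n) n, c.errorProb (Channel.deterministic f g) = 0 ∧
        c.disturbance (Channel.deterministic f g) ≤ Real.logb 2 (numMessages Rd n)) →
      c.errorProb (Channel.deterministic f g) = 0 ∧
        c.disturbance (Channel.deterministic f g) ≤ Real.logb 2 (numMessages Rd n) := by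
    intro n
    by_cases hc : ∃ c : Code X Y (numMessages R n) n,
      c.errorProb (Channel.deterministic f g) = 0 ∧
        c.disturbance (Channel.deterministic f g) ≤ Real.logb 2 (numMessages Rd n)
    · exact ⟨hc.choose, fun _ => hc.choose_spec⟩
    · exact ⟨⟨fun _ _ => Classical.arbitrary X, fun _ => ⟨0, numMessages_pos R n⟩⟩,
        fun hc' => absurd hc' hc⟩
  choose c hc using hex
  refine ⟨hR, hRd, c, ?_, ?_⟩
  · refine tendsto_const_nhds.congr' ?_
    filter_upwards [h] with n hn
    exact (hc n hn).1.symm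
  · have hlim : Filter.Tendsto (fun n : ℕ => ((Rd + 1 / (n : ℝ) : ℝ) : EReal)) Filter.atTop
        (𝓝 (Rd : EReal)) := by
      refine (continuous_coe_real_ereal.tendsto Rd).comp ?_
      simpa using tendsto_one_div_atTop_nhds_zero_nat.const_add Rd
    rw [← hlim.limsup_eq]
    refine Filter.limsup_le_limsup ?_
    filter_upwards [h, Filter.eventually_gt_atTop 0] with n hn hn0
    have hn' : (0 : ℝ) < n := by exact_mod_cast hn0
    have hpow : (1 : ℝ) ≤ 2 ^ ((n : ℝ) * Rd) := Real.one_le_rpow (by norm_num) (by positivity)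
    have hlog : Real.logb 2 (numMessages Rd n) ≤ n * Rd + 1 := by
      have h1 : (numMessages Rd n : ℝ) < 2 ^ ((n : ℝ) * Rd) + 1 := Nat.ceil_lt_add_one (by positivity)
      rw [Real.logb_le_iff_le_rpow (by norm_num) (by exact_mod_cast numMessages_pos Rd n),
        Real.rpow_add (by norm_num), Real.rpow_one]
      linarith
    rw [EReal.coe_le_coe_iff]
    calc 1 / (n : ℝ) * (c n).disturbance (Channel.deterministic f g)
        ≤ 1 / (n : ℝ) * (n * Rd + 1) := by
          gcongr
          exact (hc n hn).2.trans hlog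
      _ = Rd + 1 / n := by field_simp

theorem achievable_zero_rate [Nonempty X] (f : X → Y) (g : X → Z) {Rd : ℝ} (hRd : 0 ≤ Rd) :
    Achievable (Channel.deterministic f g) 0 Rd := by
  refine achievable_of_eventually_exists_code f g le_rfl hRd (Filter.Eventually.of_forall fun n => ?_)
  refine exists_code_of_cover f g (numMessages_pos 0 n) (numMessages_pos Rd n)
    {fun _ => Classical.arbitrary X} {fun _ => g (Classical.arbitrary X)}
    (by rw [Finset.card_singleton]; exact numMessages_pos Rd n) ?_
  simp [numMessages, Finset.filter_singleton]

/-- For large `n` there is a set of typical sequences of probability at least `3 / 4`. -/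
theorem eventually_exists_typical (f : X → Y) (g : X → Z) {p : X → ℝ} (hp : p ∈ stdSimplex ℝ X)
    {ε : ℝ} (hε : 0 < ε) :
    ∀ᶠ n : ℕ in Filter.atTop, ∃ T : Finset (Fin n → X), 3 / 4 ≤ ∑ x ∈ T, prodPMF p n x ∧
      (∀ x ∈ T, law (prodPMF p n) (fun x i => f (x i)) (fun i => f (x i)) ≤
        2 ^ (n * ε - n * entropy p f)) ∧
      (∀ x ∈ T, law (prodPMF p n) (fun x => ((fun i => f (x i)), fun i => g (x i)))
        ((fun i => f (x i)), fun i => g (x i)) ≤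
        2 ^ (n * ε - n * entropy p fun x => (f x, g x))) ∧
      ∀ x ∈ T, (2 : ℝ) ^ (-(n * ε) - n * entropy p g) ≤
        law (prodPMF p n) (fun x i => g (x i)) (fun i => g (x i)) := by
  classical
  -- Three typicality conditions fail with total probability at most 3/12, leaving 3/4.
  have hη : (0 : ℝ) < 1 / 12 := by norm_num
  filter_upwards [aep hp f hε hη, aep hp g hε hη, aep hp (fun x => (f x, g x)) hε hη]
    with n hf hg hfg
  have hP := prodPMF_mem_stdSimplex hp n
  set P := prodPMF p n with hPdef
  have hpair : ∀ x : Fin n → X, law P (fun x => ((fun i => f (x i)), fun i => g (x i)))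
      ((fun i => f (x i)), fun i => g (x i)) =
      law P (fun x i => (f (x i), g (x i))) (fun i => (f (x i), g (x i))) := by
    intro x
    exact law_comp_injective P (fun x i => (f (x i), g (x i)))
      (h := fun s : Fin n → Y × Z => ((fun i => (s i).1), fun i => (s i).2))
      (fun s t hst => by
        rw [Prod.mk.injEq, funext_iff, funext_iff] at hst
        exact funext fun i => Prod.ext (hst.1 i) (hst.2 i)) (fun i => (f (x i), g (x i)))
  set T : Finset (Fin n → X) := Finset.univ.filter fun x => P x ≠ 0 ∧
    |Real.logb 2 (law P (fun x i => f (x i)) (fun i => f (x i))) + n * entropy p f| ≤ n * ε ∧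
    |Real.logb 2 (law P (fun x i => g (x i)) (fun i => g (x i))) + n * entropy p g| ≤ n * ε ∧
    |Real.logb 2 (law P (fun x i => (f (x i), g (x i))) (fun i => (f (x i), g (x i)))) +
      n * entropy p (fun x => (f x, g x))| ≤ n * ε with hTdef
  have hT : 3 / 4 ≤ ∑ x ∈ T, P x := by
    have hsum := Finset.sum_filter_add_sum_filter_not Finset.univ (fun x => x ∈ T) P
    rw [hP.2, Finset.filter_univ_mem] at hsum
    have hbad : ∑ x with x ∉ T, P x ≤ 1 / 12 + 1 / 12 + 1 / 12 := by
      refine le_trans ?_ (add_le_add (add_le_add hf hg) hfg)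
      simp only [Finset.sum_filter, ← Finset.sum_add_distrib]
      refine Finset.sum_le_sum fun x _ => ?_
      have := hP.1 x
      by_cases hx0 : P x = 0
      · simp [hx0]
      simp only [hTdef, Finset.mem_filter, Finset.mem_univ, true_and, ne_eq, hx0, not_false_eq_true,
        forall_const]
      split_ifs <;> first | (exfalso; tauto) | linarith
    linarith
  refine ⟨T, hT, fun x hx => ?_, fun x hx => ?_, fun x hx => ?_⟩
  · obtain ⟨hx0, hx1, -, -⟩ := (Finset.mem_filter.1 hx).2
    rw [← Real.logb_le_iff_le_rpow (by norm_num) (law_pos hP.1 (fun x i => f (x i)) hx0)]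
    linarith [(abs_le.1 hx1).2]
  · obtain ⟨hx0, -, -, hx1⟩ := (Finset.mem_filter.1 hx).2
    rw [hpair, ← Real.logb_le_iff_le_rpow (by norm_num)
      (law_pos hP.1 (fun x i => (f (x i), g (x i))) hx0)]
    linarith [(abs_le.1 hx1).2]
  · obtain ⟨hx0, -, hx1, -⟩ := (Finset.mem_filter.1 hx).2
    rw [← Real.le_logb_iff_rpow_le (by norm_num) (law_pos hP.1 (fun x i => g (x i)) hx0)]
    linarith [(abs_le.1 hx1).1]

/-- Covering with u = 2^(n(ε - H(Y))), v = 2^(n(ε - H(Y,Z))), w = 2^(-n(ε + H(Z))) and K ≥ 2^(n Rd)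
yields at least the minimum of 2^(n(H(Y) - ε))/2 and 2^(n(Rd + H(Y|Z) - 2ε))/4 output sequences. -/
theorem achievable_of_lt (f : X → Y) (g : X → Z) {p : X → ℝ} (hp : p ∈ stdSimplex ℝ X)
    {R R' Rd : ℝ} (hR' : 0 ≤ R') (hlt : R' < R) (hRd : 0 ≤ Rd) (h1 : R ≤ entropy p f)
    (h2 : R - Rd ≤ condEntropy p f g) :
    Achievable (Channel.deterministic f g) R' Rd := by
  classical
  have : Nonempty X := by
    by_contra hX
    rw [not_nonempty_iff] at hX
    have := hp.2
    simp at this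
  set ε := (R - R') / 4 with hε
  have hε0 : 0 < ε := by linarith
  rw [condEntropy_eq_entropy_sub hp.1] at h2
  refine achievable_of_eventually_exists_code f g hR' hRd ?_
  -- With R = R' + 4ε, the second term of the minimum leaves a margin of 2εn in the exponent. It
  -- must pay for one bit from rounding up the number of messages and two bits from the factor 4,
  -- whence 2εn ≥ 3.
  filter_upwards [eventually_exists_typical f g hp hε0,
    tendsto_natCast_atTop_atTop.eventually_ge_atTop (3 / (2 * ε))] with n ⟨T, hT, hu, hv, hw⟩ hn
  rw [div_le_iff₀ (by positivity)] at hn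
  obtain ⟨S, hS, hcov⟩ := exists_cover (prodPMF_mem_stdSimplex hp n) (fun x i => f (x i))
    (fun x i => g (x i)) T hT (by positivity) (by positivity) hu hv hw
    (numMessages Rd n)
  refine exists_code_of_cover f g (numMessages_pos R' n) (numMessages_pos Rd n) T S hS ?_
  rw [← Nat.cast_le (α := ℝ)]
  refine le_trans (le_min ?_ ?_) hcov
  all_goals
    have hN1 : (numMessages R' n : ℝ) < 2 ^ ((n : ℝ) * R') + 1 := Nat.ceil_lt_add_one (by positivity)
    have hN2 : (1 : ℝ) ≤ 2 ^ ((n : ℝ) * R') := Real.one_le_rpow (by norm_num) (by positivity)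
    have hN : (numMessages R' n : ℝ) ≤ 2 ^ ((n : ℝ) * R' + 1) := by
      rw [Real.rpow_add (by norm_num), Real.rpow_one]
      linarith
    refine hN.trans ?_
  · rw [one_div, mul_comm (2 : ℝ), ← Real.rpow_add_one (by norm_num), ← Real.rpow_neg (by norm_num)]
    refine Real.rpow_le_rpow_of_exponent_le (by norm_num) ?_
    have : (n : ℝ) * (R' + 4 * ε) ≤ n * entropy p f := by
      gcongr
      linarith
    linarith
  · have hK : (2 : ℝ) ^ ((n : ℝ) * Rd) ≤ numMessages Rd n := Nat.le_ceil _
    refine le_trans ?_ (mul_le_mul_of_nonneg_right hK (by positivity))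
    rw [show (4 : ℝ) = 2 ^ (2 : ℝ) by norm_num, ← Real.rpow_add (by norm_num),
      ← Real.rpow_sub (by norm_num), ← Real.rpow_add (by norm_num)]
    refine Real.rpow_le_rpow_of_exponent_le (by norm_num) ?_
    have : (n : ℝ) * (R' + 4 * ε - Rd) ≤
        n * (entropy p (fun x => (f x, g x)) - entropy p g) :=
      mul_le_mul_of_nonneg_left (by linarith) (Nat.cast_nonneg n)
    linarith

theorem rateDisturbanceRegion_deterministic (f : X → Y) (g : X → Z) :
    rateDisturbanceRegion (Channel.deterministic f g) =
      {r : ℝ × ℝ | 0 ≤ r.1 ∧ 0 ≤ r.2 ∧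
        ∃ p ∈ stdSimplex ℝ X, r.1 ≤ entropy p f ∧ r.1 - r.2 ≤ condEntropy p f g} := by
  refine Set.Subset.antisymm (closure_minimal (fun r hr => ⟨hr.1, hr.2.1, converse f g hr⟩) ?_) ?_
  · exact (isClosed_le continuous_const continuous_fst).inter
      ((isClosed_le continuous_const continuous_snd).inter (isClosed_entropyRegion f g))
  · rintro ⟨R, Rd⟩ ⟨hR, hRd, p, hp, h1, h2⟩
    dsimp only at hR hRd h1 h2
    -- Positive rates are limits of achievable smaller nonnegative rates; rate 0 has none below it
    -- and uses the code with a single message.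
    rcases hR.eq_or_lt with rfl | hpos
    · have : Nonempty X := by
        by_contra hX
        rw [not_nonempty_iff] at hX
        have := hp.2
        simp at this
      exact subset_closure (achievable_zero_rate f g hRd)
    · have hlim : Filter.Tendsto (fun δ : ℝ => (R - δ, Rd)) (𝓝[>] 0) (𝓝 (R, Rd)) := by
        have : Continuous fun δ : ℝ => (R - δ, Rd) := by fun_prop
        simpa using (this.tendsto 0).mono_left nhdsWithin_le_nhds
      refine mem_closure_of_tendsto hlim ?_
      filter_upwards [Ioo_mem_nhdsGT hpos] with δ hδ
      exact achievable_of_lt f g hp (sub_nonneg.2 hδ.2.le) (by linarith [hδ.1]) hRd h1 h2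

end Achievability

end DisturbanceConstraint

end

theorem mainTheorem6 {X Y Z : Type*} [Fintype X] [Fintype Y] [Fintype Z]
    (f : X → Y) (g : X → Z) :
    DisturbanceConstraint.rateDisturbanceRegion
        (DisturbanceConstraint.Channel.deterministic f g) =
      {r : ℝ × ℝ | 0 ≤ r.1 ∧ 0 ≤ r.2 ∧
        ∃ p ∈ stdSimplex ℝ X,
          r.1 ≤ DisturbanceConstraint.entropy p f ∧
          r.1 - r.2 ≤ DisturbanceConstraint.condEntropy p f g} ∧
    DisturbanceConstraint.rateDisturbanceRegion
        (DisturbanceConstraint.Channel.deterministic f g) =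
      {r : ℝ × ℝ | 0 ≤ r.1 ∧ 0 ≤ r.2 ∧
        ∃ k : ℕ, k ≤ 2 ∧ ∃ p ∈ stdSimplex ℝ (Fin k × X),
          r.1 ≤ DisturbanceConstraint.condEntropy p (fun qx => f qx.2) (fun qx => qx.1) ∧
          DisturbanceConstraint.condMutualInfo p
            (fun qx => f qx.2) (fun qx => g qx.2) (fun qx => qx.1) ≤ r.2} := by
  have h := DisturbanceConstraint.rateDisturbanceRegion_deterministic f g
  refine ⟨h, h.trans ?_⟩
  ext r
  exact and_congr_right fun _ => and_congr_right fun hr =>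
    DisturbanceConstraint.entropyRegion_iff_timeSharing f g hr
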